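/- Let $n\ge 1$ and $m\ge 0$ be integers and let $f=(f_1,\dots,f_n)$, where each $f_j$ is a polynomial of total degree at most $2$ in $X_1,\dots,X_n$ with nonnegative real coefficients, each nonzero coefficient being a quotient $p/q$ of integers $0\le p<2^m$, $0<q<2^m$. Assume that - $f$ is feasible, i.e. $f(y)=y$ for some $y\in\mathbb{R}_{\ge 0}^n$; - $f$ is clean, i.e. for every $j$ there is a $k\ge 0$ such that the $j$-th component of $f^k(0)$ is positive; - $f$ is strongly connected, i.e. any $X_j$ and $X_l$ are related by the reflexive transitive closure of the relation "$\partial f_j/\partial X_l$ is not the zero polynomial". Then $f$ has a least fixed point $\mu f$ in $\mathbb{R}_{\ge 0}^n$ (with respect to the componentwise order), all components of $\mu f$ are positive, and the Newton sequence $$\nu^{(0)}=0,\qquad \nu^{(k+1)}=\nu^{(k)}+\bigl(\mathrm{Id}-f'(\nu^{(k)})\bigr)^{-1}\bigl(f(\nu^{(k)})-\nu^{(k)}\bigr)$$ is well defined, i.e. $\mathrm{Id}-f'(\nu^{(k)})$ is invertible for every $k\ge 0$, where $f'$ denotes the Jacobian matrix of $f$. Moreover, with $\mu_{\min}=\min_j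 (\mu f)_j$ and $$k_f = 3n^2m+2n^2\,|\log_2\mu_{\min}|,$$ the vector $\nu^{(\lceil k_f\rceil+i)}$ has at least $i$ valid bits of $\mu f$ for every integer $i\ge 0$, that is, $$\frac{\bigl|(\mu f)_j-\nu^{(\lceil k_f\rceil+i)}_j\bigr|}{|(\mu f)_j|}\le 2^{-i}\qquad\text{for all } 1\le j\le n.$$ -/

import Mathlib

namespace PolySystem

/-- A system of `n` real polynomials in the variables `X_1, …, X_n`; its coefficients and the
dependence relation are those of the polynomials in normal form. -/
abbrev Sys (n : ℕ) : Type := Fin n → MvPolynomial (Fin n) ℝ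

variable {n : ℕ}

/-- The vector function `x ↦ f(x)`. -/
noncomputable def value (f : Sys n) (x : Fin n → ℝ) : Fin n → ℝ :=
  fun j => MvPolynomial.eval x (f j)

/-- All coefficients are nonnegative. -/
def IsMonotoneSystem (f : Sys n) : Prop :=
  ∀ (j : Fin n) (s : Fin n →₀ ℕ), 0 ≤ (f j).coeff s

/-- The nonnegative fixed points of `f`. -/
def fixedPointSet (f : Sys n) : Set (Fin n → ℝ) :=
  {x | 0 ≤ x ∧ value f x = x}

/-- There is at least one nonnegative fixed point. -/
def IsFeasible (f : Sys n) : Prop := (fixedPointSet f).Nonempty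

/-- The Kleene sequence `0, f(0), f(f(0)), …`. -/
noncomputable def kleeneSeq (f : Sys n) (k : ℕ) : Fin n → ℝ := (value f)^[k] 0

/-- Every variable is productive. -/
def IsClean (f : Sys n) : Prop := ∀ j : Fin n, ∃ k : ℕ, 0 < kleeneSeq f k j

/-- Every monomial has degree at most 2. -/
def IsQuadratic (f : Sys n) : Prop := ∀ j : Fin n, (f j).totalDegree ≤ 2

/-- `X_j` depends directly on `X_l`: the polynomial `∂f_j/∂X_l` is not zero. -/
def DependsDirectly (f : Sys n) (j l : Fin n) : Prop := MvPolynomial.pderiv l (f j) ≠ 0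

/-- Any two variables depend on each other. -/
def IsStronglyConnected (f : Sys n) : Prop :=
  ∀ j l : Fin n, Relation.ReflTransGen (DependsDirectly f) j l

/-- Every (nonzero) coefficient is a ratio of two `m`-bit integers. -/
def HasBitCoeffs (f : Sys n) (m : ℕ) : Prop :=
  ∀ (j : Fin n) (s : Fin n →₀ ℕ), (f j).coeff s ≠ 0 →
    ∃ p q : ℕ, p < 2 ^ m ∧ q < 2 ^ m ∧ q ≠ 0 ∧ (f j).coeff s = (p : ℝ) / (q : ℝ)

/-- The Jacobian matrix `f'(x)`. -/
noncomputable def jacobian (f : Sys n) (x : Fin n → ℝ) : Matrix (Fin n) (Fin n) ℝ :=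
  Matrix.of fun j l => MvPolynomial.eval x (MvPolynomial.pderiv l (f j))

/-- The Newton operator `x ↦ x + (Id - f'(x))⁻¹ (f(x) - x)`; it is meaningful only where
`Id - f'(x)` is invertible. -/
noncomputable def newtonOp (f : Sys n) (x : Fin n → ℝ) : Fin n → ℝ :=
  x + Matrix.mulVec (1 - jacobian f x)⁻¹ (value f x - x)

/-- The Newton sequence, started at `0`. -/
noncomputable def newtonSeq (f : Sys n) (k : ℕ) : Fin n → ℝ := (newtonOp f)^[k] 0

/-- The vector `v` has (at least) `i` valid bits of the vector `μ`. -/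
def HasValidBits (μ v : Fin n → ℝ) (i : ℕ) : Prop :=
  ∀ j : Fin n, |μ j - v j| / |μ j| ≤ (2 : ℝ) ^ (-(i : ℤ))

/-- The threshold `3 n² m + 2 n² |log₂ μ_min|`, where `μ_min` is the minimal component of `μ`
(a minimum for `0 < n`, the infimum being over a nonempty finite family). -/
noncomputable def threshold (n m : ℕ) (μ : Fin n → ℝ) : ℝ :=
  3 * (n : ℝ) ^ 2 * (m : ℝ) + 2 * (n : ℝ) ^ 2 * |Real.logb 2 (⨅ j : Fin n, μ j)|

end PolySystem

namespace PolySystem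

variable {n : ℕ}

open Finset Matrix Filter Topology

/-! Write `B` for the symmetric bilinear map of second derivatives; for quadratic `f` all Taylor
expansions are exact. The Kleene iterates increase to the least fixed point `μ`. If `B = 0`, one
Newton step lands on `μ` (`newtonOp_eq_of_hess_eq_zero`). Otherwise there is a cone vector `d > 0`
with `f'(μ) d ≤ d` (`exists_cone_vector`). It makes `Id - f'(x)` invertible with nonnegative inverse
for `0 ≤ x < μ`, and each Newton step halves the error measured in units of `d`: `μ - x ≤ t d`
yields an error at most `(t/2) d` (`newtonOp_step`). It remains to bound the initial `t`. Strong
connectedness and the lower bound on coefficients limit the ratios between components of `μ`, and of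
`d`; a quadratic term bounds `μ` from above (`sub_newtonSeq_le`). The threshold absorbs these
constants (`two_pow_threshold`). -/

/-! ### Exact Taylor expansion of quadratic systems. -/

theorem induction_of_totalDegree_le_two {P : MvPolynomial (Fin n) ℝ → Prop}
    (hC : ∀ c, P (MvPolynomial.C c))
    (hX : ∀ c a, P (MvPolynomial.C c * MvPolynomial.X a))
    (hXX : ∀ c a b, P (MvPolynomial.C c * MvPolynomial.X a * MvPolynomial.X b))
    (hadd : ∀ p q, P p → P q → P (p + q))
    (p : MvPolynomial (Fin n) ℝ) (hp : p.totalDegree ≤ 2) : P p := by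
  rw [p.as_sum]
  refine Finset.sum_induction _ P hadd (by simpa using hC 0) fun s hs => ?_
  have hdeg : s.degree ≤ 2 := (MvPolynomial.le_totalDegree hs).trans hp
  rcases eq_or_ne s 0 with rfl | h0
  · exact hC _
  obtain ⟨a, ha⟩ := Finsupp.ne_iff.1 h0
  have hsa : s = (s - Finsupp.single a 1) + Finsupp.single a 1 := by
    refine (tsub_add_cancel_of_le ?_).symm
    rw [Finsupp.single_le_iff]
    exact Nat.one_le_iff_ne_zero.2 ha
  generalize s - Finsupp.single a 1 = t at hsa
  have hdt : t.degree ≤ 1 := by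
    have := hdeg
    rw [hsa, map_add, Finsupp.degree_single] at this
    omega
  rcases eq_or_ne t 0 with rfl | h1
  · rw [zero_add] at hsa
    have := hX (MvPolynomial.coeff s p) a
    rwa [MvPolynomial.C_mul_X_eq_monomial, ← hsa] at this
  obtain ⟨b, hb⟩ := Finsupp.ne_iff.1 h1
  have htb : t = (t - Finsupp.single b 1) + Finsupp.single b 1 := by
    refine (tsub_add_cancel_of_le ?_).symm
    rw [Finsupp.single_le_iff]
    exact Nat.one_le_iff_ne_zero.2 hb
  generalize t - Finsupp.single b 1 = u at htb
  have hu : u = 0 := by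
    rw [htb, map_add, Finsupp.degree_single] at hdt
    exact (Finsupp.degree_eq_zero_iff u).1 (by omega)
  subst hu
  rw [zero_add] at htb
  subst htb
  have := hXX (MvPolynomial.coeff s p) b a
  generalize MvPolynomial.coeff s p = r at *
  rw [hsa]
  convert this using 1
  rw [MvPolynomial.X, MvPolynomial.X, MvPolynomial.C_mul_monomial, MvPolynomial.monomial_mul]
  simp

/-- The (constant) second partial derivatives of a quadratic system. -/
noncomputable def hess (f : Sys n) (i a b : Fin n) : ℝ :=
  MvPolynomial.constantCoeff (MvPolynomial.pderiv a (MvPolynomial.pderiv b (f i)))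

/-- The bilinear map given by the second derivatives. -/
noncomputable def bil (f : Sys n) (v w : Fin n → ℝ) (i : Fin n) : ℝ :=
  ∑ a, ∑ b, hess f i a b * v a * w b

/-- Keeps the Kronecker delta opaque, so that the product rule can be expanded before any case
distinction appears. -/
theorem exists_pderiv_X_eq_C (n : ℕ) : ∃ e : Fin n → Fin n → ℝ,
    (∀ a l, MvPolynomial.pderiv l (MvPolynomial.X a : MvPolynomial (Fin n) ℝ)
      = MvPolynomial.C (e a l)) ∧ ∀ a l, e a l = if a = l then 1 else 0 := by
  refine ⟨fun a l => if a = l then 1 else 0, fun a l => ?_, fun _ _ => rfl⟩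
  by_cases h : a = l
  · subst h; simp
  · simp [MvPolynomial.pderiv_X_of_ne h, h]

theorem eval_pderiv_add (p : MvPolynomial (Fin n) ℝ) (hp : p.totalDegree ≤ 2) (l : Fin n)
    (x v : Fin n → ℝ) :
    MvPolynomial.eval (x + v) (MvPolynomial.pderiv l p)
      = MvPolynomial.eval x (MvPolynomial.pderiv l p)
      + ∑ a, MvPolynomial.constantCoeff (MvPolynomial.pderiv a (MvPolynomial.pderiv l p)) * v a := by
  obtain ⟨e, he, he'⟩ := exists_pderiv_X_eq_C n
  revert p
  refine induction_of_totalDegree_le_two ?_ ?_ ?_ ?_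
  · intro c
    simp
  · intro c a
    simp [-MvPolynomial.pderiv_X, he]
  · intro c a b
    simp [-MvPolynomial.pderiv_X, he, add_mul, mul_add, Finset.sum_add_distrib]
    simp [he']
    ring_nf
  · intro p q hp hq
    simp only [map_add, hp, hq, add_mul, Finset.sum_add_distrib]
    ring

theorem eval_add_of_totalDegree_le_two (p : MvPolynomial (Fin n) ℝ) (hp : p.totalDegree ≤ 2)
    (x v : Fin n → ℝ) :
    MvPolynomial.eval (x + v) p = MvPolynomial.eval x p
      + ∑ l, MvPolynomial.eval x (MvPolynomial.pderiv l p) * v l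
      + 1 / 2 * ∑ a, ∑ b, MvPolynomial.constantCoeff
          (MvPolynomial.pderiv a (MvPolynomial.pderiv b p)) * v a * v b := by
  obtain ⟨e, he, he'⟩ := exists_pderiv_X_eq_C n
  revert p
  refine induction_of_totalDegree_le_two ?_ ?_ ?_ ?_
  · intro c
    simp
  · intro c a
    simp [-MvPolynomial.pderiv_X, he, mul_add]
    simp [he']
  · intro c a b
    simp [-MvPolynomial.pderiv_X, he, add_mul, mul_add, Finset.sum_add_distrib]
    simp [he']
    ring_nf
  · intro p q hp hq
    simp only [map_add, hp, hq, add_mul, Finset.sum_add_distrib]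
    ring

theorem value_add {f : Sys n} (hq : IsQuadratic f) (x v : Fin n → ℝ) (i : Fin n) :
    value f (x + v) i = value f x i + (jacobian f x *ᵥ v) i + 1 / 2 * bil f v v i := by
  simp only [value, bil, hess, jacobian, mulVec, dotProduct, of_apply]
  exact eval_add_of_totalDegree_le_two (f i) (hq i) x v

theorem jacobian_add {f : Sys n} (hq : IsQuadratic f) (x v : Fin n → ℝ) (i l : Fin n) :
    jacobian f (x + v) i l = jacobian f x i l + ∑ a, hess f i a l * v a :=
  eval_pderiv_add (f i) (hq i) l x v

theorem jacobian_add_mulVec {f : Sys n} (hq : IsQuadratic f) (x v w : Fin n → ℝ) (i : Fin n) :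
    (jacobian f (x + v) *ᵥ w) i = (jacobian f x *ᵥ w) i + bil f v w i := by
  simp only [mulVec, dotProduct, jacobian_add hq, add_mul, Finset.sum_add_distrib, bil,
    Finset.sum_mul]
  exact congrArg _ Finset.sum_comm

theorem hess_symm (f : Sys n) (i a b : Fin n) : hess f i a b = hess f i b a := by
  simp only [hess, MvPolynomial.constantCoeff_eq, MvPolynomial.coeff_pderiv]
  by_cases h : a = b
  · subst h; rfl
  · simp [h, Ne.symm h, add_comm]

theorem hess_eq (f : Sys n) (i a b : Fin n) : ∃ s, ∃ k : ℕ, 1 ≤ k ∧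
    hess f i a b = (f i).coeff s * k := by
  refine ⟨Finsupp.single a 1 + Finsupp.single b 1, Finsupp.single a 1 b + 1, by omega, ?_⟩
  simp only [hess, MvPolynomial.constantCoeff_eq, MvPolynomial.coeff_pderiv]
  simp

theorem bil_comm (f : Sys n) (v w : Fin n → ℝ) : bil f v w = bil f w v := by
  funext i
  simp only [bil]
  rw [Finset.sum_comm]
  refine Finset.sum_congr rfl fun a _ => Finset.sum_congr rfl fun b _ => ?_
  rw [hess_symm f i b a]; ring

theorem bil_smul_left (f : Sys n) (t : ℝ) (v w : Fin n → ℝ) (i : Fin n) :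
    bil f (t • v) w i = t * bil f v w i := by
  simp only [bil, Finset.mul_sum, Pi.smul_apply, smul_eq_mul]
  refine Finset.sum_congr rfl fun a _ => Finset.sum_congr rfl fun b _ => ?_
  ring

/-! ### Positivity and monotonicity. -/

theorem hess_nonneg {f : Sys n} (hf : IsMonotoneSystem f) (i a b : Fin n) : 0 ≤ hess f i a b := by
  obtain ⟨s, k, -, h⟩ := hess_eq f i a b
  rw [h]
  exact mul_nonneg (hf i s) (Nat.cast_nonneg k)

theorem bil_nonneg {f : Sys n} (hf : IsMonotoneSystem f) {v w : Fin n → ℝ} (hv : 0 ≤ v)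
    (hw : 0 ≤ w) (i : Fin n) : 0 ≤ bil f v w i :=
  Finset.sum_nonneg fun a _ => Finset.sum_nonneg fun b _ =>
    mul_nonneg (mul_nonneg (hess_nonneg hf i a b) (hv a)) (hw b)

theorem bil_mono {f : Sys n} (hf : IsMonotoneSystem f) {v v' w w' : Fin n → ℝ} (hv : 0 ≤ v)
    (hw : 0 ≤ w) (hvv : v ≤ v') (hww : w ≤ w') (i : Fin n) : bil f v w i ≤ bil f v' w' i := by
  refine Finset.sum_le_sum fun a _ => Finset.sum_le_sum fun b _ => ?_
  exact mul_le_mul (mul_le_mul_of_nonneg_left (hvv a) (hess_nonneg hf i a b)) (hww b) (hw b)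
    (mul_nonneg (hess_nonneg hf i a b) ((hv a).trans (hvv a)))

theorem hess_mul_le_bil {f : Sys n} (hf : IsMonotoneSystem f) {v w : Fin n → ℝ} (hv : 0 ≤ v)
    (hw : 0 ≤ w) (i a b : Fin n) : hess f i a b * v a * w b ≤ bil f v w i := by
  have hnn : ∀ a b, 0 ≤ hess f i a b * v a * w b := fun a b =>
    mul_nonneg (mul_nonneg (hess_nonneg hf i a b) (hv a)) (hw b)
  exact (Finset.single_le_sum (f := fun b => hess f i a b * v a * w b)
    (fun b _ => hnn a b) (Finset.mem_univ b)).trans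
    (Finset.single_le_sum (f := fun a => ∑ b, hess f i a b * v a * w b)
      (fun a _ => Finset.sum_nonneg fun b _ => hnn a b) (Finset.mem_univ a))

theorem jacobian_zero (f : Sys n) (i l : Fin n) :
    jacobian f 0 i l = (f i).coeff (Finsupp.single l 1) := by
  simp [jacobian, MvPolynomial.constantCoeff_eq, MvPolynomial.coeff_pderiv]

theorem jacobian_eq {f : Sys n} (hq : IsQuadratic f) (x : Fin n → ℝ) (i l : Fin n) :
    jacobian f x i l = jacobian f 0 i l + ∑ a, hess f i a l * x a := by
  simpa using jacobian_add hq 0 x i l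

theorem jacobian_zero_nonneg {f : Sys n} (hf : IsMonotoneSystem f) (i l : Fin n) :
    0 ≤ jacobian f 0 i l := by
  rw [jacobian_zero]; exact hf i _

theorem jacobian_zero_le {f : Sys n} (hf : IsMonotoneSystem f) (hq : IsQuadratic f)
    {x : Fin n → ℝ} (hx : 0 ≤ x) (i l : Fin n) : jacobian f 0 i l ≤ jacobian f x i l := by
  rw [jacobian_eq hq x]
  exact le_add_of_nonneg_right (Finset.sum_nonneg fun a _ => mul_nonneg (hess_nonneg hf i a l) (hx a))

theorem hess_mul_le_jacobian {f : Sys n} (hf : IsMonotoneSystem f) (hq : IsQuadratic f)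
    {x : Fin n → ℝ} (hx : 0 ≤ x) (i a l : Fin n) : hess f i a l * x a ≤ jacobian f x i l := by
  rw [jacobian_eq hq x]
  have := Finset.single_le_sum (f := fun a => hess f i a l * x a)
    (fun a _ => mul_nonneg (hess_nonneg hf i a l) (hx a)) (Finset.mem_univ a)
  have h0 := jacobian_zero_nonneg hf i l
  linarith

theorem jacobian_nonneg {f : Sys n} (hf : IsMonotoneSystem f) (hq : IsQuadratic f)
    {x : Fin n → ℝ} (hx : 0 ≤ x) (i l : Fin n) : 0 ≤ jacobian f x i l :=
  (jacobian_zero_nonneg hf i l).trans (jacobian_zero_le hf hq hx i l)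

theorem mulVec_nonneg_of_nonneg {A : Matrix (Fin n) (Fin n) ℝ} (hA : ∀ i j, 0 ≤ A i j)
    {v : Fin n → ℝ} (hv : 0 ≤ v) (i : Fin n) : 0 ≤ (A *ᵥ v) i :=
  dotProduct_nonneg_of_nonneg (hA i) hv

theorem mul_le_mulVec {A : Matrix (Fin n) (Fin n) ℝ} (hA : ∀ i j, 0 ≤ A i j)
    {v : Fin n → ℝ} (hv : 0 ≤ v) (i j : Fin n) : A i j * v j ≤ (A *ᵥ v) i :=
  Finset.single_le_sum (f := fun j => A i j * v j) (fun j _ => mul_nonneg (hA i j) (hv j))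
    (Finset.mem_univ j)

theorem DependsDirectly.cases {f : Sys n} (hq : IsQuadratic f) {i l : Fin n}
    (h : DependsDirectly f i l) : jacobian f 0 i l ≠ 0 ∨ ∃ a, hess f i a l ≠ 0 := by
  by_contra! hc
  refine h (MvPolynomial.funext fun x => ?_)
  have := jacobian_eq hq x i l
  rw [hc.1] at this
  simpa [hc.2, jacobian] using this

theorem value_nonneg {f : Sys n} (hf : IsMonotoneSystem f) {x : Fin n → ℝ} (hx : 0 ≤ x) :
    0 ≤ value f x := by
  intro i
  simp only [value, MvPolynomial.eval_eq, Pi.zero_apply]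
  exact Finset.sum_nonneg fun s _ => mul_nonneg (hf i s)
    (Finset.prod_nonneg fun j _ => pow_nonneg (hx j) _)

theorem value_mono {f : Sys n} (hf : IsMonotoneSystem f) {x y : Fin n → ℝ} (hx : 0 ≤ x)
    (hxy : x ≤ y) : value f x ≤ value f y := by
  intro i
  simp only [value, MvPolynomial.eval_eq]
  refine Finset.sum_le_sum fun s _ => mul_le_mul_of_nonneg_left ?_ (hf i s)
  exact Finset.prod_le_prod (fun j _ => pow_nonneg (hx j) _)
    fun j _ => pow_le_pow_left₀ (hx j) (hxy j) _

theorem continuous_value (f : Sys n) : Continuous (value f) :=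
  continuous_pi fun i => MvPolynomial.continuous_eval (f i)

theorem continuous_jacobian (f : Sys n) : Continuous (jacobian f) :=
  continuous_matrix fun i l => MvPolynomial.continuous_eval (MvPolynomial.pderiv l (f i))

/-! ### The Kleene sequence and the least fixed point. -/

theorem kleeneSeq_succ (f : Sys n) (k : ℕ) : kleeneSeq f (k + 1) = value f (kleeneSeq f k) :=
  Function.iterate_succ_apply' _ _ _

theorem kleeneSeq_nonneg {f : Sys n} (hf : IsMonotoneSystem f) (k : ℕ) : 0 ≤ kleeneSeq f k := by
  induction k with
  | zero => exact le_rfl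
  | succ k ih => rw [kleeneSeq_succ]; exact value_nonneg hf ih

theorem kleeneSeq_le_succ {f : Sys n} (hf : IsMonotoneSystem f) (k : ℕ) :
    kleeneSeq f k ≤ kleeneSeq f (k + 1) := by
  induction k with
  | zero => exact kleeneSeq_nonneg hf 1
  | succ k ih =>
    rw [kleeneSeq_succ, kleeneSeq_succ f (k + 1)]
    exact value_mono hf (kleeneSeq_nonneg hf k) ih

theorem kleeneSeq_le_fixed {f : Sys n} (hf : IsMonotoneSystem f) {y : Fin n → ℝ}
    (hy : y ∈ fixedPointSet f) (k : ℕ) : kleeneSeq f k ≤ y := by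
  induction k with
  | zero => exact hy.1
  | succ k ih =>
    rw [kleeneSeq_succ, ← hy.2]
    exact value_mono hf (kleeneSeq_nonneg hf k) ih

theorem exists_isLeast_tendsto {f : Sys n} (hf : IsMonotoneSystem f) (hfeas : IsFeasible f) :
    ∃ μ, IsLeast (fixedPointSet f) μ ∧ Tendsto (kleeneSeq f) atTop (𝓝 μ) := by
  obtain ⟨y, hy⟩ := hfeas
  have hmono : Monotone (kleeneSeq f) := monotone_nat_of_le_succ (kleeneSeq_le_succ hf)
  have hlim : ∀ j, Tendsto (fun k => kleeneSeq f k j) atTop (𝓝 (⨆ k, kleeneSeq f k j)) := fun j =>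
    tendsto_atTop_ciSup (fun k l h => hmono h j)
      ⟨y j, by rintro _ ⟨k, rfl⟩; exact kleeneSeq_le_fixed hf hy k j⟩
  have ht : Tendsto (kleeneSeq f) atTop (𝓝 fun j => ⨆ k, kleeneSeq f k j) := tendsto_pi_nhds.2 hlim
  refine ⟨_, ⟨⟨ge_of_tendsto' ht (kleeneSeq_nonneg hf), ?_⟩, fun z hz =>
    le_of_tendsto' ht (kleeneSeq_le_fixed hf hz)⟩, ht⟩
  refine tendsto_nhds_unique (((continuous_value f).tendsto _).comp ht) ?_
  refine ((tendsto_add_atTop_iff_nat 1).2 ht).congr fun k => ?_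
  exact kleeneSeq_succ f k

/-! ### Nonnegative matrices and strong connectedness. -/

/-- A comparison vector `d > 0` with `A d ≤ d`, strict in some row of an irreducible system, makes
`1 - A` invertible with nonnegative inverse. -/
theorem nonneg_of_mulVec_le {A : Matrix (Fin n) (Fin n) ℝ} (hA : ∀ i j, 0 ≤ A i j)
    {R : Fin n → Fin n → Prop} (hR : ∀ i j, Relation.ReflTransGen R i j) {d : Fin n → ℝ}
    (hd : ∀ i, 0 < d i) (hAd : ∀ i, (A *ᵥ d) i ≤ d i)
    (hrow : ∀ i, (A *ᵥ d) i < d i ∨ ∀ j, R i j → 0 < A i j)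
    (hstrict : ∃ i, (A *ᵥ d) i < d i) {w : Fin n → ℝ} (hw : ∀ i, (A *ᵥ w) i ≤ w i) : 0 ≤ w := by
  obtain ⟨i₀, hi₀⟩ := hstrict
  have : Nonempty (Fin n) := ⟨i₀⟩
  obtain ⟨i₁, hi₁⟩ := Finite.exists_min fun i => w i / d i
  set t := w i₁ / d i₁ with ht
  have hle : ∀ i, t * d i ≤ w i := fun i => (le_div_iff₀ (hd i)).1 (hi₁ i)
  by_cases h0 : 0 ≤ t
  · exact fun i => (mul_nonneg h0 (hd i).le).trans (hle i)
  exfalso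
  push Not at h0
  -- If the minimal ratio `t` is negative, the rows where `w = t d` are never strict and are closed
  -- under `R`; by connectedness they include the strict row `i₀`.
  have key : ∀ i, w i = t * d i → ¬ (A *ᵥ d) i < d i ∧ ∀ j, 0 < A i j → w j = t * d j := by
    intro i hi
    have hsub : (A *ᵥ (w - t • d)) i = (A *ᵥ w) i - t * (A *ᵥ d) i := by
      rw [mulVec_sub, mulVec_smul]; rfl
    have hnn : 0 ≤ w - t • d := fun j => sub_nonneg.2 (hle j)
    have h1 := hw i
    have h2 := hAd i
    have h3 := mulVec_nonneg_of_nonneg hA hnn i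
    rw [hsub] at h3
    constructor
    · intro h
      nlinarith
    · intro j hj
      have h4 := mul_le_mulVec hA hnn i j
      rw [hsub] at h4
      have h5 : A i j * (w j - t * d j) ≤ 0 := by
        refine h4.trans ?_
        nlinarith
      have h6 := hle j
      have : w j - t * d j ≤ 0 := nonpos_of_mul_nonpos_right h5 hj
      linarith
  have hall : ∀ j, Relation.ReflTransGen R i₁ j → w j = t * d j := by
    intro j hj
    induction hj with
    | refl => rw [ht, div_mul_cancel₀ _ (hd i₁).ne']
    | tail _ hab ih =>
      rename_i a b _
      rcases hrow a with h | h
      · exact absurd h (key a ih).1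
      · exact (key a ih).2 b (h b hab)
  exact (key i₀ (hall i₀ (hR i₁ i₀))).1 hi₀

theorem isUnit_one_sub {A : Matrix (Fin n) (Fin n) ℝ}
    (h : ∀ w : Fin n → ℝ, (∀ i, (A *ᵥ w) i ≤ w i) → 0 ≤ w) : IsUnit (1 - A) := by
  rw [← mulVec_injective_iff_isUnit]
  have hz : ∀ w : Fin n → ℝ, (1 - A) *ᵥ w = 0 → w = 0 := by
    intro w hw
    rw [sub_mulVec, one_mulVec, sub_eq_zero] at hw
    refine le_antisymm ?_ (h w fun i => by rw [← hw])
    have := h (-w) fun i => by rw [mulVec_neg, ← hw]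
    exact neg_nonneg.1 this
  intro v w hvw
  exact sub_eq_zero.1 (hz _ (by rw [mulVec_sub]; exact sub_eq_zero.2 hvw))

/-- Propagation of comparisons along a strongly connected relation. -/
theorem pow_mul_le_of_reflTransGen {R : Fin n → Fin n → Prop}
    (hR : ∀ i j, Relation.ReflTransGen R i j) {C : ℝ} (hC0 : 0 ≤ C) (hC1 : C ≤ 1)
    {v : Fin n → ℝ} (hv : 0 ≤ v) (hstep : ∀ i j, R i j → C * v j ≤ v i) (i j : Fin n) :
    C ^ (n - 1) * v j ≤ v i := by
  classical
  set S : ℕ → Finset (Fin n) := fun k => Finset.univ.filter fun i => C ^ k * v j ≤ v i with hS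
  -- Until `S k` is everything, some edge enters it from outside, so each step adds an index; `n -
  -- 1` steps suffice since `S 0` contains `j`.
  have hcard : ∀ k, min n (k + 1) ≤ (S k).card := by
    intro k
    induction k with
    | zero =>
      refine (min_le_right _ _).trans (Finset.card_pos.2 ⟨j, ?_⟩)
      simp [hS]
    | succ k ih =>
      have hsub : S k ⊆ S (k + 1) := by
        intro i hi
        simp only [hS, Finset.mem_filter, Finset.mem_univ, true_and] at hi ⊢
        refine le_trans (mul_le_mul_of_nonneg_right ?_ (hv j)) hi
        exact pow_le_pow_of_le_one hC0 hC1 (Nat.le_succ k)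
      by_cases huniv : S k = Finset.univ
      · have : S (k + 1) = Finset.univ := Finset.univ_subset_iff.1 (huniv ▸ hsub)
        rw [this]; simp
      obtain ⟨a, ha⟩ : ∃ a, a ∉ S k := by
        by_contra! h
        exact huniv (Finset.eq_univ_iff_forall.2 h)
      have hj : j ∈ S k := by
        simp only [hS, Finset.mem_filter, Finset.mem_univ, true_and]
        exact mul_le_of_le_one_left (hv j) (pow_le_one₀ hC0 hC1)
      have hedge : ∃ a b, a ∉ S k ∧ b ∈ S k ∧ R a b := by
        by_contra! h
        have : ∀ b, Relation.ReflTransGen R a b → b ∉ S k := by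
          intro b hb
          induction hb with
          | refl => exact ha
          | tail _ hab ih' => exact fun hmem => h _ _ ih' hmem hab
        exact this j (hR a j) hj
      obtain ⟨a, b, ha, hb, hab⟩ := hedge
      have : insert a (S k) ⊆ S (k + 1) := by
        refine Finset.insert_subset ?_ hsub
        simp only [hS, Finset.mem_filter, Finset.mem_univ, true_and] at hb ⊢
        refine le_trans ?_ (hstep a b hab)
        rw [pow_succ', mul_assoc]
        exact mul_le_mul_of_nonneg_left hb hC0
      have := Finset.card_le_card this
      rw [Finset.card_insert_of_notMem ha] at this
      omega
  have hn : 0 < n := i.pos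
  have h := hcard (n - 1)
  have hfull : S (n - 1) = Finset.univ := by
    refine Finset.eq_univ_of_card _ (le_antisymm (Finset.card_le_univ _) ?_)
    rw [Fintype.card_fin]
    omega
  have : i ∈ S (n - 1) := hfull ▸ Finset.mem_univ i
  simpa [hS] using this

/-! ### Identities for the Newton operator. -/

theorem newtonOp_sub {f : Sys n} {x : Fin n → ℝ} (hu : IsUnit (1 - jacobian f x)) (i : Fin n) :
    (newtonOp f x - x) i = (jacobian f x *ᵥ (newtonOp f x - x)) i + (value f x i - x i) := by
  have h : (1 - jacobian f x) *ᵥ (newtonOp f x - x) = value f x - x := by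
    rw [newtonOp, add_sub_cancel_left, mulVec_mulVec,
      mul_nonsing_inv _ ((isUnit_iff_isUnit_det _).1 hu), one_mulVec]
  rw [sub_mulVec, one_mulVec] at h
  have := congrFun h i
  simp only [Pi.sub_apply] at this ⊢
  linarith

/-- The linear part of the Taylor expansion cancels by the choice of the step. The remainder is
nonnegative, so the invariant `x ≤ f(x)` survives a Newton step. -/
theorem value_newtonOp {f : Sys n} (hq : IsQuadratic f) {x : Fin n → ℝ}
    (hu : IsUnit (1 - jacobian f x)) (i : Fin n) :
    value f (newtonOp f x) i
      = newtonOp f x i + 1 / 2 * bil f (newtonOp f x - x) (newtonOp f x - x) i := by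
  have h := value_add hq x (newtonOp f x - x) i
  rw [add_sub_cancel] at h
  have h' := newtonOp_sub hu i
  rw [Pi.sub_apply] at h'
  linarith

theorem sub_newtonOp {f : Sys n} (hq : IsQuadratic f) {x μ : Fin n → ℝ} (hμ : value f μ = μ)
    (hu : IsUnit (1 - jacobian f x)) (i : Fin n) :
    (μ - newtonOp f x) i
      = (jacobian f x *ᵥ (μ - newtonOp f x)) i + 1 / 2 * bil f (μ - x) (μ - x) i := by
  have h := value_add hq x (μ - x) i
  rw [add_sub_cancel, hμ] at h
  have h' := newtonOp_sub hu i
  have hs : μ - newtonOp f x = (μ - x) - (newtonOp f x - x) := by abel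
  rw [hs, mulVec_sub]
  simp only [Pi.sub_apply] at h' ⊢
  linarith

theorem newtonSeq_succ (f : Sys n) (k : ℕ) : newtonSeq f (k + 1) = newtonOp f (newtonSeq f k) :=
  Function.iterate_succ_apply' _ _ _

/-- Without quadratic terms in the row, a dependency must come from a linear term, so positivity
holds even where `x` has zero components. -/
theorem jacobian_pos_of_hess_eq_zero {f : Sys n} (hf : IsMonotoneSystem f) (hq : IsQuadratic f)
    {x : Fin n → ℝ} (hx : 0 ≤ x) {i : Fin n} (hi : ∀ a b, hess f i a b = 0) {j : Fin n}
    (hij : DependsDirectly f i j) : 0 < jacobian f x i j := by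
  rcases hij.cases hq with h | ⟨a, h⟩
  · exact ((jacobian_zero_nonneg hf i j).lt_of_ne' h).trans_le (jacobian_zero_le hf hq hx i j)
  · exact absurd (hi a j) h

theorem bil_pos {f : Sys n} (hf : IsMonotoneSystem f) {v w : Fin n → ℝ} (hv : ∀ i, 0 < v i)
    (hw : ∀ i, 0 < w i) {i a b : Fin n} (h : hess f i a b ≠ 0) : 0 < bil f v w i :=
  (mul_pos (mul_pos ((hess_nonneg hf i a b).lt_of_ne' h) (hv a)) (hw b)).trans_le
    (hess_mul_le_bil hf (fun j => (hv j).le) (fun j => (hw j).le) i a b)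

/-! ### The affine case. -/

/-- In an affine system, the Newton operator maps everything to the fixed point. -/
theorem newtonOp_eq_of_hess_eq_zero {f : Sys n} (hf : IsMonotoneSystem f) (hq : IsQuadratic f)
    (hsc : IsStronglyConnected f) (hclean : IsClean f) (hn : 0 < n)
    (hH : ∀ i a b, hess f i a b = 0) {μ : Fin n → ℝ} (hμ : value f μ = μ) (hpos : ∀ j, 0 < μ j)
    (x : Fin n → ℝ) : IsUnit (1 - jacobian f x) ∧ newtonOp f x = μ := by
  have hbil : ∀ v w : Fin n → ℝ, ∀ i, bil f v w i = 0 := fun v w i => by simp [bil, hH]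
  have hJ : jacobian f x = jacobian f 0 := by
    ext i l
    rw [jacobian_eq hq]
    simp [hH]
  have heq : ∀ i, μ i = value f 0 i + (jacobian f 0 *ᵥ μ) i := fun i => by
    have := value_add hq 0 μ i
    rwa [zero_add, hμ, hbil, mul_zero, add_zero] at this
  have h0 : 0 ≤ value f 0 := value_nonneg hf le_rfl
  -- If `f(0) = 0`, the Kleene sequence would stay at `0`, against cleanness. This supplies the
  -- strict row for the comparison vector `μ`.
  have hex : ∃ i, 0 < value f 0 i := by
    by_contra! h
    have hz : value f 0 = 0 := le_antisymm h h0
    obtain ⟨k, hk⟩ := hclean ⟨0, hn⟩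
    rw [kleeneSeq, Function.iterate_fixed hz] at hk
    exact lt_irrefl _ hk
  have hM : ∀ w : Fin n → ℝ, (∀ i, (jacobian f x *ᵥ w) i ≤ w i) → 0 ≤ w := by
    rw [hJ]
    intro w hw
    refine nonneg_of_mulVec_le (jacobian_zero_nonneg hf) hsc hpos (fun i => ?_) (fun i => ?_) ?_ hw
    · linarith [heq i, show (0 : ℝ) ≤ value f 0 i from h0 i]
    · exact Or.inr fun j hij => jacobian_pos_of_hess_eq_zero hf hq le_rfl (hH i) hij
    · obtain ⟨i, hi⟩ := hex
      exact ⟨i, by linarith [heq i]⟩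
  have hu := isUnit_one_sub hM
  refine ⟨hu, ?_⟩
  have hw : ∀ i, (μ - newtonOp f x) i = (jacobian f x *ᵥ (μ - newtonOp f x)) i := fun i => by
    rw [sub_newtonOp hq hμ hu i, hbil, mul_zero, add_zero]
  have h1 := hM _ fun i => (hw i).ge
  have h2 := hM (-(μ - newtonOp f x)) fun i => by
    rw [mulVec_neg, Pi.neg_apply, Pi.neg_apply, ← hw i]
  exact (sub_eq_zero.1 (le_antisymm (neg_nonneg.1 h2) h1)).symm

/-! ### Halving of the Newton error along a cone vector. -/

/-- Below a positive fixed point with a cone vector `d`, the matrix `1 - f'(x)` has nonnegative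
inverse. -/
theorem nonneg_of_jacobian_mulVec_le {f : Sys n} (hf : IsMonotoneSystem f) (hq : IsQuadratic f)
    (hsc : IsStronglyConnected f) (hH : ∃ i a b, hess f i a b ≠ 0) {μ d x : Fin n → ℝ}
    (hd : ∀ i, 0 < d i) (hcone : ∀ i, (jacobian f μ *ᵥ d) i ≤ d i) (hx : 0 ≤ x)
    (hxμ : ∀ i, x i < μ i) {w : Fin n → ℝ} (hw : ∀ i, (jacobian f x *ᵥ w) i ≤ w i) : 0 ≤ w := by
  have hv : ∀ i, 0 < (μ - x) i := fun i => sub_pos.2 (hxμ i)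
  -- The gap `B(μ - x, d)` makes every row with a quadratic term strict; the other rows have
  -- positive entries at all dependencies.
  have hJ : ∀ i, (jacobian f μ *ᵥ d) i = (jacobian f x *ᵥ d) i + bil f (μ - x) d i := fun i => by
    have := jacobian_add_mulVec hq x (μ - x) d i
    rwa [add_sub_cancel] at this
  have hb : ∀ i, 0 ≤ bil f (μ - x) d i :=
    bil_nonneg hf (fun j => (hv j).le) fun j => (hd j).le
  refine nonneg_of_mulVec_le (jacobian_nonneg hf hq hx) hsc hd (fun i => ?_) (fun i => ?_) ?_ hw
  · linarith [hJ i, hb i, hcone i]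
  · by_cases h : ∃ a b, hess f i a b ≠ 0
    · obtain ⟨a, b, h⟩ := h
      left
      linarith [hJ i, bil_pos hf hv hd h, hcone i]
    · push Not at h
      exact Or.inr fun j hij => jacobian_pos_of_hess_eq_zero hf hq hx h hij
  · obtain ⟨i, a, b, h⟩ := hH
    exact ⟨i, by linarith [hJ i, bil_pos hf hv hd h, hcone i]⟩

theorem newtonOp_step {f : Sys n} (hf : IsMonotoneSystem f) (hq : IsQuadratic f)
    (hsc : IsStronglyConnected f) (hH : ∃ i a b, hess f i a b ≠ 0) {μ d x : Fin n → ℝ}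
    (hμ : value f μ = μ) (hd : ∀ i, 0 < d i) (hcone : ∀ i, (jacobian f μ *ᵥ d) i ≤ d i)
    (hx : 0 ≤ x) (hxf : x ≤ value f x) (hxμ : ∀ i, x i < μ i) {t : ℝ} (ht : μ - x ≤ t • d) :
    IsUnit (1 - jacobian f x) ∧ 0 ≤ newtonOp f x ∧ newtonOp f x ≤ value f (newtonOp f x) ∧
      (∀ i, newtonOp f x i < μ i) ∧ μ - newtonOp f x ≤ (t / 2) • d := by
  have hM : ∀ w : Fin n → ℝ, (∀ i, (jacobian f x *ᵥ w) i ≤ w i) → 0 ≤ w := fun w hw =>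
    nonneg_of_jacobian_mulVec_le hf hq hsc hH hd hcone hx hxμ hw
  have hu := isUnit_one_sub hM
  have hv : ∀ i, 0 < (μ - x) i := fun i => sub_pos.2 (hxμ i)
  have hv0 : 0 ≤ μ - x := fun i => (hv i).le
  have hδ : 0 ≤ newtonOp f x - x := hM _ fun i => by
    linarith [newtonOp_sub hu i, hxf i]
  have hw := sub_newtonOp hq hμ hu
  have hb := bil_nonneg hf hv0 hv0
  have hw0 : 0 ≤ μ - newtonOp f x := hM _ fun i => by linarith [hw i, hb i]
  refine ⟨hu, hx.trans (sub_nonneg.1 hδ), fun i => ?_, fun i => ?_, ?_⟩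
  · linarith [value_newtonOp hq hu i, bil_nonneg hf hδ hδ i]
  · by_contra hi
    -- A vanishing error component forces a row without quadratic terms and hence vanishing errors
    -- at all its dependencies; this spreads to a row with a quadratic term, where the error is
    -- positive.
    have hzero : ∀ j, Relation.ReflTransGen (DependsDirectly f) i j →
        (μ - newtonOp f x) j = 0 := by
      intro j hj
      induction hj with
      | refl => exact le_antisymm (sub_nonpos.2 (not_lt.1 hi)) (hw0 i)
      | tail _ hab ih =>
        rename_i a b _
        have hJw := mulVec_nonneg_of_nonneg (jacobian_nonneg hf hq hx) hw0 a
        have hrow : ∀ c e, hess f a c e = 0 := by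
          intro c e
          by_contra h
          linarith [hw a, bil_pos hf hv hv h]
        have hpos := jacobian_pos_of_hess_eq_zero hf hq hx hrow hab
        have hle := mul_le_mulVec (jacobian_nonneg hf hq hx) hw0 a b
        refine le_antisymm (nonpos_of_mul_nonpos_right ?_ hpos) (hw0 b)
        linarith [hw a, hb a]
    obtain ⟨j, a, b, h⟩ := hH
    have hJw := mulVec_nonneg_of_nonneg (jacobian_nonneg hf hq hx) hw0 j
    linarith [hw j, bil_pos hf hv hv h, hzero j (hsc i j)]
  -- Here `B(μ-x, μ-x) ≤ t B(μ-x, d) = t (f'(μ) d - f'(x) d) ≤ t (d - f'(x) d)`; the factor `1/2` in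
  -- the error equation gives `t / 2`.
  · refine sub_nonneg.1 (hM _ fun i => ?_)
    have h1 : bil f (μ - x) (μ - x) i ≤ t * bil f (μ - x) d i := by
      refine (bil_mono hf hv0 hv0 le_rfl ht i).trans ?_
      rw [bil_comm, bil_smul_left, bil_comm]
    have h2 : (jacobian f μ *ᵥ d) i = (jacobian f x *ᵥ d) i + bil f (μ - x) d i := by
      have := jacobian_add_mulVec hq x (μ - x) d i
      rwa [add_sub_cancel] at this
    have ht0 : 0 ≤ t := by
      have : 0 ≤ t * d i := (hv0 i).trans (ht i)
      exact nonneg_of_mul_nonneg_left this (hd i)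
    have h3 : t * bil f (μ - x) d i ≤ t * (d i - (jacobian f x *ᵥ d) i) :=
      mul_le_mul_of_nonneg_left (by linarith [hcone i]) ht0
    have h4 := hw i
    rw [mulVec_sub, mulVec_smul]
    simp only [Pi.sub_apply, Pi.smul_apply, smul_eq_mul] at h4 ⊢
    linarith

/-! ### Existence of a cone vector. -/

theorem exists_mulVec_le_of_tendsto {B : ℕ → Matrix (Fin n) (Fin n) ℝ}
    {A : Matrix (Fin n) (Fin n) ℝ} (hB : Tendsto B atTop (𝓝 A)) {e : ℕ → Fin n → ℝ}
    (he0 : ∀ k, 0 ≤ e k) (hne : ∀ k, e k ≠ 0) (he : ∀ k i, (B k *ᵥ e k) i ≤ e k i) :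
    ∃ d : Fin n → ℝ, 0 ≤ d ∧ d ≠ 0 ∧ ∀ i, (A *ᵥ d) i ≤ d i := by
  obtain ⟨d, hd, φ, hφ, hφd⟩ := (isCompact_sphere (0 : Fin n → ℝ) 1).tendsto_subseq
    (x := fun k => ‖e k‖⁻¹ • e k) fun k => by
      rw [mem_sphere_zero_iff_norm, norm_smul, norm_inv, norm_norm,
        inv_mul_cancel₀ (norm_ne_zero_iff.2 (hne k))]
  have hd0 : 0 ≤ d := ge_of_tendsto' hφd fun k =>
    smul_nonneg (inv_nonneg.2 (norm_nonneg _)) (he0 _)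
  have hc : Continuous fun p : Matrix (Fin n) (Fin n) ℝ × (Fin n → ℝ) => p.1 *ᵥ p.2 :=
    continuous_fst.matrix_mulVec continuous_snd
  have h1 : Tendsto (fun k => B (φ k) *ᵥ (‖e (φ k)‖⁻¹ • e (φ k))) atTop (𝓝 (A *ᵥ d)) :=
    (hc.tendsto (A, d)).comp ((hB.comp hφ.tendsto_atTop).prodMk_nhds hφd)
  refine ⟨d, hd0, ?_, fun i => ?_⟩
  · rintro rfl
    simp at hd
  · refine le_of_tendsto_of_tendsto' (tendsto_pi_nhds.1 h1 i) (tendsto_pi_nhds.1 hφd i) fun k => ?_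
    rw [mulVec_smul]
    exact mul_le_mul_of_nonneg_left (he (φ k) i) (inv_nonneg.2 (norm_nonneg _))

/-- The cone vector of a nonlinear strongly connected system: a limit of normalized Kleene errors. -/
theorem exists_cone_vector {f : Sys n} (hf : IsMonotoneSystem f) (hq : IsQuadratic f)
    (hsc : IsStronglyConnected f) (hH : ∃ i a b, hess f i a b ≠ 0) {μ : Fin n → ℝ}
    (hμ : value f μ = μ) (hpos : ∀ j, 0 < μ j) (hlim : Tendsto (kleeneSeq f) atTop (𝓝 μ)) :
    ∃ d : Fin n → ℝ, (∀ i, 0 < d i) ∧ ∀ i, (jacobian f μ *ᵥ d) i ≤ d i := by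
  have hfix : μ ∈ fixedPointSet f := ⟨fun j => (hpos j).le, hμ⟩
  set e : ℕ → Fin n → ℝ := fun k => μ - kleeneSeq f k with he
  have hnn : ∀ k, 0 ≤ kleeneSeq f k := kleeneSeq_nonneg hf
  have hsucc : ∀ k i, e (k + 1) i
      = (jacobian f (kleeneSeq f k) *ᵥ e k) i + 1 / 2 * bil f (e k) (e k) i := by
    intro k i
    have := value_add hq (kleeneSeq f k) (e k) i
    rw [he, add_sub_cancel, hμ, ← kleeneSeq_succ] at this
    simp only [he, Pi.sub_apply] at this ⊢
    linarith
  have he0 : ∀ k, 0 ≤ e k := fun k => sub_nonneg.2 (kleeneSeq_le_fixed hf hfix k)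
  -- Since Kleene errors decrease, each is a cone vector for the Jacobian at its own iterate; this
  -- passes to the limit.
  have hcone : ∀ k i, (jacobian f (kleeneSeq f k) *ᵥ e k) i ≤ e k i := by
    intro k i
    have h1 : e (k + 1) i ≤ e k i := sub_le_sub_left (kleeneSeq_le_succ hf k i) _
    linarith [hsucc k i, bil_nonneg hf (he0 k) (he0 k) i]
  have hepos : ∀ k i, 0 < e k i := by
    intro k
    induction k with
    | zero => intro i; simpa [he, kleeneSeq] using hpos i
    | succ k ih =>
      intro i
      rw [hsucc k i]
      have hJ := jacobian_nonneg hf hq (hnn k)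
      by_cases h : ∃ a b, hess f i a b ≠ 0
      · obtain ⟨a, b, h⟩ := h
        linarith [mulVec_nonneg_of_nonneg hJ (he0 k) i, bil_pos hf ih ih h]
      · push Not at h
        obtain ⟨i₀, a, b, h₀⟩ := hH
        rcases Relation.ReflTransGen.cases_head (hsc i i₀) with rfl | ⟨j, hij, -⟩
        · exact absurd (h a b) h₀
        · have h1 := jacobian_pos_of_hess_eq_zero hf hq (hnn k) h hij
          have h2 := mul_le_mulVec hJ (he0 k) i j
          linarith [mul_pos h1 (ih j), bil_nonneg hf (he0 k) (he0 k) i]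
  have hne : ∀ k, e k ≠ 0 := by
    obtain ⟨i₀, -⟩ := hH
    exact fun k h => (hepos k i₀).ne' (congrFun h i₀)
  obtain ⟨d, hd0, hdne, hdJ⟩ := exists_mulVec_le_of_tendsto
    (((continuous_jacobian f).tendsto μ).comp hlim) he0 hne hcone
  refine ⟨d, fun i => ?_, hdJ⟩
  obtain ⟨j, hj⟩ := Function.ne_iff.1 hdne
  have hJpos : ∀ a b, DependsDirectly f a b → 0 < jacobian f μ a b := by
    intro a b hab
    rcases hab.cases hq with h | ⟨c, h⟩
    · exact ((jacobian_zero_nonneg hf a b).lt_of_ne' h).trans_le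
        (jacobian_zero_le hf hq hfix.1 a b)
    · exact (mul_pos ((hess_nonneg hf a c b).lt_of_ne' h) (hpos c)).trans_le
        (hess_mul_le_jacobian hf hq hfix.1 a c b)
  -- Positivity of one component of `d` spreads backwards along dependencies, because `f'(μ)` is
  -- positive on them.
  refine Relation.ReflTransGen.head_induction_on (hsc i j) ((hd0 j).lt_of_ne' hj) ?_
  intro a c hac _ ih
  exact (mul_pos (hJpos a c hac) ih).trans_le
    ((mul_le_mulVec (jacobian_nonneg hf hq hfix.1) hd0 a c).trans (hdJ a))

theorem newtonSeq_error {f : Sys n} (hf : IsMonotoneSystem f) (hq : IsQuadratic f)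
    (hsc : IsStronglyConnected f) (hH : ∃ i a b, hess f i a b ≠ 0) {μ d : Fin n → ℝ}
    (hμ : value f μ = μ) (hpos : ∀ j, 0 < μ j) (hd : ∀ i, 0 < d i)
    (hcone : ∀ i, (jacobian f μ *ᵥ d) i ≤ d i) {t : ℝ} (ht : μ ≤ t • d) (k : ℕ) :
    IsUnit (1 - jacobian f (newtonSeq f k)) ∧ (∀ i, newtonSeq f k i < μ i) ∧
      μ - newtonSeq f k ≤ (t / 2 ^ k) • d := by
  have hinv : ∀ k, 0 ≤ newtonSeq f k ∧ newtonSeq f k ≤ value f (newtonSeq f k) ∧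
      (∀ i, newtonSeq f k i < μ i) ∧ μ - newtonSeq f k ≤ (t / 2 ^ k) • d := by
    intro k
    induction k with
    | zero => exact ⟨le_rfl, value_nonneg hf le_rfl, hpos, by simpa [newtonSeq] using ht⟩
    | succ k ih =>
      obtain ⟨h0, h1, h2, h3⟩ := ih
      rw [newtonSeq_succ, pow_succ, ← div_div]
      exact (newtonOp_step hf hq hsc hH hμ hd hcone h0 h1 h2 h3).2
  obtain ⟨h0, h1, h2, h3⟩ := hinv k
  exact ⟨(newtonOp_step hf hq hsc hH hμ hd hcone h0 h1 h2 h3).1, h2, h3⟩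

/-! ### Quantitative bounds from the coefficient size. -/

theorem HasBitCoeffs.le_coeff {f : Sys n} {m : ℕ} (hc : HasBitCoeffs f m)
    {j : Fin n} {s : Fin n →₀ ℕ} (h : (f j).coeff s ≠ 0) :
    ((1 : ℝ) / 2) ^ m ≤ (f j).coeff s := by
  obtain ⟨p, q, -, hq, hq0, hpq⟩ := hc j s h
  have hq' : (0 : ℝ) < q := by exact_mod_cast Nat.pos_of_ne_zero hq0
  have hp : 1 ≤ p := by
    rw [Nat.one_le_iff_ne_zero]
    rintro rfl
    simp [hpq] at h
  have hqm : (q : ℝ) ≤ 2 ^ m := by exact_mod_cast hq.le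
  rw [hpq, _root_.one_div_pow]
  exact div_le_div₀ (by positivity) (by exact_mod_cast hp) hq' hqm

theorem HasBitCoeffs.le_hess {f : Sys n} {m : ℕ} (hf : IsMonotoneSystem f)
    (hc : HasBitCoeffs f m) {i a b : Fin n} (h : hess f i a b ≠ 0) :
    ((1 : ℝ) / 2) ^ m ≤ hess f i a b := by
  obtain ⟨s, k, hk, hs⟩ := hess_eq f i a b
  rw [hs] at h ⊢
  refine (hc.le_coeff (left_ne_zero_of_mul h)).trans ?_
  exact le_mul_of_one_le_right (hf i s) (by exact_mod_cast hk)

theorem HasBitCoeffs.le_jacobian_zero {f : Sys n} {m : ℕ}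
    (hc : HasBitCoeffs f m) {i l : Fin n} (h : jacobian f 0 i l ≠ 0) :
    ((1 : ℝ) / 2) ^ m ≤ jacobian f 0 i l := by
  rw [jacobian_zero] at h ⊢
  exact hc.le_coeff h

theorem HasBitCoeffs.le_jacobian {f : Sys n} {m : ℕ} (hf : IsMonotoneSystem f)
    (hq : IsQuadratic f) (hc : HasBitCoeffs f m) {μ : Fin n → ℝ} {τ : ℝ} (hτ0 : 0 ≤ τ) (hτ1 : τ ≤ 1)
    (hτ : ∀ j, τ ≤ μ j) {i l : Fin n} (h : DependsDirectly f i l) :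
    ((1 : ℝ) / 2) ^ m * τ ≤ jacobian f μ i l := by
  have hμ : 0 ≤ μ := fun j => hτ0.trans (hτ j)
  rcases h.cases hq with h | ⟨a, h⟩
  · refine le_trans ?_ (jacobian_zero_le hf hq hμ i l)
    exact (mul_le_of_le_one_right (by positivity) hτ1).trans (hc.le_jacobian_zero h)
  · refine le_trans ?_ (hess_mul_le_jacobian hf hq hμ i a l)
    exact mul_le_mul (hc.le_hess hf h) (hτ a) hτ0 (hess_nonneg hf i a l)

theorem half_jacobian_mulVec_le {f : Sys n} (hf : IsMonotoneSystem f) (hq : IsQuadratic f)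
    {μ : Fin n → ℝ} (hμ0 : 0 ≤ μ) (hμ : value f μ = μ) (i : Fin n) :
    1 / 2 * (jacobian f μ *ᵥ μ) i ≤ μ i := by
  have h1 := value_add hq 0 μ i
  have h2 := jacobian_add_mulVec hq 0 μ μ i
  rw [zero_add] at h1 h2
  rw [hμ] at h1
  have h3 : 0 ≤ value f 0 i := value_nonneg hf le_rfl i
  have h4 := mulVec_nonneg_of_nonneg (jacobian_zero_nonneg hf) hμ0 i
  linarith

theorem half_hess_mul_le {f : Sys n} (hf : IsMonotoneSystem f) (hq : IsQuadratic f)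
    {μ : Fin n → ℝ} (hμ0 : 0 ≤ μ) (hμ : value f μ = μ) (i a b : Fin n) :
    1 / 2 * (hess f i a b * μ a * μ b) ≤ μ i := by
  have h1 := value_add hq 0 μ i
  rw [zero_add, hμ] at h1
  have h3 : 0 ≤ value f 0 i := value_nonneg hf le_rfl i
  have h4 := mulVec_nonneg_of_nonneg (jacobian_zero_nonneg hf) hμ0 i
  linarith [hess_mul_le_bil hf hμ0 hμ0 i a b]

/-- Newton error bound for nonlinear strongly connected systems, in terms of a lower bound `τ` for
the components of the least fixed point. -/
theorem sub_newtonSeq_le {f : Sys n} {m : ℕ} (hf : IsMonotoneSystem f) (hq : IsQuadratic f)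
    (hsc : IsStronglyConnected f) (hc : HasBitCoeffs f m) (hH : ∃ i a b, hess f i a b ≠ 0)
    {μ d : Fin n → ℝ} (hμ : value f μ = μ) (hd : ∀ i, 0 < d i)
    (hcone : ∀ i, (jacobian f μ *ᵥ d) i ≤ d i) {τ : ℝ} (hτ0 : 0 < τ) (hτ1 : τ ≤ 1)
    (hτ : ∀ j, τ ≤ μ j) (k : ℕ) (j : Fin n) :
    (μ - newtonSeq f k) j * ((1 / 2) ^ (m + 1) * τ) ^ (3 * n - 2) ≤ τ / 2 ^ k := by
  have hpos : ∀ j, 0 < μ j := fun j => hτ0.trans_le (hτ j)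
  have hμ0 : 0 ≤ μ := fun j => (hpos j).le
  -- Half the coefficient bound, to absorb the `1/2` of the Taylor expansion.
  set c : ℝ := (1 / 2) ^ (m + 1) with hcdef
  have hc0 : 0 < c := by positivity
  have hc2 : ((1 : ℝ) / 2) ^ m = 2 * c := by rw [hcdef, pow_succ]; ring
  have hc1 : c ≤ 1 := pow_le_one₀ (by norm_num) (by norm_num)
  have hC0 : 0 < c * τ := mul_pos hc0 hτ0
  have hC1 : c * τ ≤ 1 := mul_le_one₀ hc1 hτ0.le hτ1
  have hJ : ∀ i l, DependsDirectly f i l → 2 * (c * τ) ≤ jacobian f μ i l := fun i l h => by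
    have := hc.le_jacobian hf hq hτ0.le hτ1 hτ h
    rwa [hc2, mul_assoc] at this
  have hJ0 := jacobian_nonneg hf hq hμ0
  set P := (c * τ) ^ (n - 1) with hP
  have hP0 : 0 < P := pow_pos hC0 _
  have hPμ : ∀ i l, P * μ l ≤ μ i :=
    pow_mul_le_of_reflTransGen hsc hC0.le hC1 hμ0 fun i l hil => by
      have h1 := half_jacobian_mulVec_le hf hq hμ0 hμ i
      have h2 := mul_le_mulVec hJ0 hμ0 i l
      have h3 := mul_le_mul_of_nonneg_right (hJ i l hil) (hμ0 l)
      linarith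
  have hPd : ∀ i l, P * d l ≤ d i :=
    pow_mul_le_of_reflTransGen hsc hC0.le hC1 (fun l => (hd l).le) fun i l hil => by
      have h1 := hcone i
      have h2 := mul_le_mulVec hJ0 (fun l => (hd l).le) i l
      have h3 := mul_le_mul_of_nonneg_right (hJ i l hil) (hd l).le
      have h4 := mul_pos hC0 (hd l)
      linarith
  -- A quadratic term gives `c μ_a μ_b ≤ μ_i ≤ μ_a / P`. Hence `μ_b ≤ 1/(P c)`, and comparing `μ_l`
  -- with `μ_b` costs another factor `P`.
  have hmax : ∀ l, P ^ 2 * c * μ l ≤ 1 := by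
    intro l
    obtain ⟨i, a, b, h⟩ := hH
    have h1 := half_hess_mul_le hf hq hμ0 hμ i a b
    have h2 := hc.le_hess hf h
    rw [hc2] at h2
    have h3 : 2 * c * (μ a * μ b) ≤ hess f i a b * (μ a * μ b) :=
      mul_le_mul_of_nonneg_right h2 (mul_pos (hpos a) (hpos b)).le
    have h4 : c * (μ a * μ b) ≤ μ i := by linarith
    have h5 : P * (c * (μ a * μ b)) ≤ μ a := (mul_le_mul_of_nonneg_left h4 hP0.le).trans (hPμ a i)
    have h6 : P * c * μ b ≤ 1 := by
      refine le_of_mul_le_mul_right ?_ (hpos a)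
      linarith
    calc P ^ 2 * c * μ l = P * c * (P * μ l) := by ring
      _ ≤ P * c * μ b := mul_le_mul_of_nonneg_left (hPμ b l) (mul_pos hP0 hc0).le
      _ ≤ 1 := h6
  have : Nonempty (Fin n) := ⟨j⟩
  obtain ⟨i₀, hi₀⟩ := Finite.exists_min d
  have hden : 0 < P ^ 2 * c * d i₀ := by have := hd i₀; positivity
  have ht : μ ≤ (1 / (P ^ 2 * c * d i₀)) • d := by
    intro l
    rw [Pi.smul_apply, smul_eq_mul, div_mul_eq_mul_div, one_mul, le_div_iff₀ hden]
    calc μ l * (P ^ 2 * c * d i₀) = P ^ 2 * c * μ l * d i₀ := by ring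
      _ ≤ 1 * d l := mul_le_mul (hmax l) (hi₀ l) (hd i₀).le zero_le_one
      _ = d l := one_mul _
  have herr := (newtonSeq_error hf hq hsc hH hμ hpos hd hcone ht k).2.2 j
  rw [Pi.smul_apply, smul_eq_mul] at herr
  have hn : 0 < n := j.pos
  -- Two factors `P` come from bounding `μ`, the third from `d j / d i₀ ≤ 1 / P`; the extra `τ`
  -- matches the one on the right-hand side.
  have hexp : (c * τ) ^ (3 * n - 2) = P ^ 2 * c * P * τ := by
    rw [show 3 * n - 2 = (n - 1) * 3 + 1 by omega, pow_succ, pow_mul]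
    ring
  rw [hexp]
  calc (μ - newtonSeq f k) j * (P ^ 2 * c * P * τ)
      ≤ 1 / (P ^ 2 * c * d i₀) / 2 ^ k * d j * (P ^ 2 * c * P * τ) :=
        mul_le_mul_of_nonneg_right herr (by positivity)
    _ = τ / 2 ^ k * (P * d j / d i₀) := by
        have := (hd i₀).ne'
        field_simp
    _ ≤ τ / 2 ^ k * 1 := by
        refine mul_le_mul_of_nonneg_left ?_ (by positivity)
        exact (div_le_one (hd i₀)).2 (hPd i₀ j)
    _ = τ / 2 ^ k := mul_one _

/-! ### From the error bound to valid bits. -/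

theorem hasValidBits_of_le {μ v : Fin n → ℝ} {i : ℕ} (hpos : ∀ j, 0 < μ j) (hv : v ≤ μ)
    (h : ∀ j, (μ - v) j ≤ μ j / 2 ^ i) : HasValidBits μ v i := by
  intro j
  rw [abs_of_pos (hpos j), abs_of_nonneg (sub_nonneg.2 (hv j)), div_le_iff₀ (hpos j),
    _root_.zpow_neg, zpow_natCast, inv_mul_eq_div]
  exact h j

theorem two_rpow_neg_abs_logb_le {x : ℝ} (hx : 0 < x) : (2 : ℝ) ^ (-|Real.logb 2 x|) ≤ x := by
  conv_rhs => rw [← Real.rpow_logb (b := 2) (by norm_num) (by norm_num) hx]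
  exact Real.rpow_le_rpow_of_exponent_le (by norm_num) (neg_abs_le _)

/-- With `ℓ = |log₂ μ_min|` this reduces to `(3n-2)(m+1+ℓ) ≤ 3n²m + 2n²ℓ`. The hypothesis `1 ≤ m`
enters through `m + 1 ≤ 2m`. -/
theorem two_pow_threshold {m : ℕ} (hm : 1 ≤ m) (hn : 0 < n) (μ : Fin n → ℝ) :
    1 / (2 : ℝ) ^ ⌈threshold n m μ⌉₊
      ≤ ((1 / 2) ^ (m + 1) * (2 : ℝ) ^ (-|Real.logb 2 (⨅ j : Fin n, μ j)|)) ^ (3 * n - 2) := by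
  have hT := Nat.le_ceil (threshold n m μ)
  unfold threshold at hT ⊢
  set ℓ := |Real.logb 2 (⨅ j : Fin n, μ j)| with hℓ
  have hℓ0 : 0 ≤ ℓ := abs_nonneg _
  set N := ⌈3 * (n : ℝ) ^ 2 * (m : ℝ) + 2 * (n : ℝ) ^ 2 * ℓ⌉₊
  have h1 : 1 / (2 : ℝ) ^ N = 2 ^ (-(N : ℝ)) := by
    rw [Real.rpow_neg (by norm_num), Real.rpow_natCast, one_div]
  have h2 : ((1 : ℝ) / 2) ^ (m + 1) = 2 ^ (-((m + 1 : ℕ) : ℝ)) := by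
    rw [Real.rpow_neg (by norm_num), Real.rpow_natCast, _root_.one_div_pow, one_div]
  rw [h1, h2, ← Real.rpow_add (by norm_num), ← Real.rpow_mul_natCast (by norm_num)]
  refine Real.rpow_le_rpow_of_exponent_le (by norm_num) ?_
  rw [Nat.cast_sub (by omega)]
  push_cast
  have hm' : (1 : ℝ) ≤ m := by exact_mod_cast hm
  have hn' : (1 : ℝ) ≤ n := by exact_mod_cast hn
  have ha : (3 * (n : ℝ) - 2) * ℓ ≤ 2 * (n : ℝ) ^ 2 * ℓ :=
    mul_le_mul_of_nonneg_right (by nlinarith [sq_nonneg ((n : ℝ) - 1)]) hℓ0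
  have hb : (3 * (n : ℝ) - 2) * (m + 1) ≤ (3 * (n : ℝ) - 2) * (2 * m) :=
    mul_le_mul_of_nonneg_left (by linarith) (by linarith)
  have hd : (6 * (n : ℝ) - 4) * m ≤ 3 * (n : ℝ) ^ 2 * m :=
    mul_le_mul_of_nonneg_right (by nlinarith [sq_nonneg ((n : ℝ) - 1)]) (by linarith)
  linarith

end PolySystem

theorem corollary3p3 (n m : ℕ) (hn : 0 < n) (f : PolySystem.Sys n)
    (hmono : PolySystem.IsMonotoneSystem f)
    (hfeas : PolySystem.IsFeasible f)
    (hclean : PolySystem.IsClean f)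
    (hquad : PolySystem.IsQuadratic f)
    (hsc : PolySystem.IsStronglyConnected f)
    (hcoeff : PolySystem.HasBitCoeffs f m) :
    ∃ μ : Fin n → ℝ,
      -- `μ` is the least nonnegative fixed point, and all its components are positive
      IsLeast (PolySystem.fixedPointSet f) μ ∧ (∀ j : Fin n, 0 < μ j) ∧
      -- the Newton sequence is well defined
      (∀ k : ℕ, IsUnit (1 - PolySystem.jacobian f (PolySystem.newtonSeq f k))) ∧
      ∀ i : ℕ, PolySystem.HasValidBits μ
        (PolySystem.newtonSeq f (⌈PolySystem.threshold n m μ⌉₊ + i)) i := by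
  open PolySystem in
  obtain ⟨μ, hleast, hlim⟩ := exists_isLeast_tendsto hmono hfeas
  have hμ := hleast.1.2
  have hpos : ∀ j, 0 < μ j := fun j => by
    obtain ⟨k, hk⟩ := hclean j
    exact hk.trans_le (kleeneSeq_le_fixed hmono hleast.1 k j)
  by_cases hH : ∃ i a b, hess f i a b ≠ 0
  · obtain ⟨d, hd, hcone⟩ := exists_cone_vector hmono hquad hsc hH hμ hpos hlim
    have : Nonempty (Fin n) := ⟨⟨0, hn⟩⟩
    -- Any finite multiple will do here: it serves only invertibility and `ν < μ`.
    have hdiv : μ ≤ (∑ j, μ j / d j) • d := fun j => by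
      rw [Pi.smul_apply, smul_eq_mul, ← div_le_iff₀ (hd j)]
      exact Finset.single_le_sum (f := fun j => μ j / d j)
        (fun l _ => (div_pos (hpos l) (hd l)).le) (Finset.mem_univ j)
    have hseq := newtonSeq_error hmono hquad hsc hH hμ hpos hd hcone hdiv
    refine ⟨μ, hleast, hpos, fun k => (hseq k).1, fun i => ?_⟩
    -- A nonzero coefficient exists, and `m = 0` would leave no admissible denominator.
    have hm : 1 ≤ m := by
      obtain ⟨i, a, b, h⟩ := hH
      obtain ⟨s, k, -, hs⟩ := hess_eq f i a b
      rw [hs] at h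
      obtain ⟨p, q, -, hq, hq0, -⟩ := hcoeff i s (left_ne_zero_of_mul h)
      by_contra hm
      obtain rfl : m = 0 := by omega
      simp at hq
      exact hq0 hq
    -- Equals `min(μ_min, 1/μ_min)`, hence is at most both `1` and `μ_min`.
    set τ : ℝ := 2 ^ (-|Real.logb 2 (⨅ j : Fin n, μ j)|) with hτdef
    have hτ0 : 0 < τ := Real.rpow_pos_of_pos (by norm_num) _
    have hτ1 : τ ≤ 1 := Real.rpow_le_one_of_one_le_of_nonpos (by norm_num) (by simp)
    have hinf : 0 < ⨅ j, μ j := by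
      obtain ⟨j, hj⟩ := exists_eq_ciInf_of_finite (f := μ)
      exact hj ▸ hpos j
    have hτ : ∀ j, τ ≤ μ j := fun j =>
      (two_rpow_neg_abs_logb_le hinf).trans (ciInf_le (Set.finite_range μ).bddBelow j)
    refine hasValidBits_of_le hpos (fun j => ((hseq _).2.1 j).le) fun j => ?_
    have herr := sub_newtonSeq_le hmono hquad hsc hcoeff hH hμ hd hcone hτ0 hτ1 hτ
      (⌈threshold n m μ⌉₊ + i) j
    have hthr := two_pow_threshold hm hn μ
    rw [← hτdef] at hthr
    have hnn : 0 ≤ (μ - newtonSeq f (⌈threshold n m μ⌉₊ + i)) j := sub_nonneg.2 ((hseq _).2.1 j).le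
    have hle := (mul_le_mul_of_nonneg_left hthr hnn).trans herr
    rw [pow_add, mul_one_div, ← div_div, div_right_comm,
      div_le_div_iff_of_pos_right (by positivity)] at hle
    exact hle.trans (div_le_div_of_nonneg_right (hτ j) (by positivity))
  · push Not at hH
    have hnewton := newtonOp_eq_of_hess_eq_zero hmono hquad hsc hclean hn hH hμ hpos
    refine ⟨μ, hleast, hpos, fun k => (hnewton _).1, fun i => ?_⟩
    have hle : ∀ k, newtonSeq f k ≤ μ := by
      rintro (_ | k)
      · exact fun j => (hpos j).le
      · rw [newtonSeq_succ, (hnewton _).2]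
    refine hasValidBits_of_le hpos (hle _) fun j => ?_
    -- For `i = 0` possibly no Newton step has been taken, but then only `0 ≤ ν` is needed.
    rcases i with _ | i
    · rw [pow_zero, div_one, Pi.sub_apply, sub_le_self_iff]
      rcases ⌈threshold n m μ⌉₊ with _ | k
      · exact le_rfl
      · rw [add_zero, newtonSeq_succ, (hnewton _).2]
        exact (hpos j).le
    · rw [← add_assoc, newtonSeq_succ, (hnewton _).2, sub_self]
      exact (div_pos (hpos j) (by positivity)).le
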